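/- **Setting.** Let $f:\mathbb R^N\to\mathbb R$. Use one of two families of deterministic perturbation vectors $d_0,\dots,d_{L-1}\in\mathbb R^N$ and a factor $c$: * *semi-lexicographic*: $L=3^N$, $c=\frac1{2\cdot 3^N}$, and $d_m$ is the $m$-th row ($m=0,\dots,3^N-1$) of the $3^N\times N$ matrix $D_N$, where $D_1=(-1,-1,2)^{\mathsf T}$ and, recursively, the first column of $D_{k+1}$ consists of $2\cdot 3^k$ entries $-1$ followed by $3^k$ entries $2$, while columns $2,\dots,k+1$ of $D_{k+1}$ are the columns $1,\dots,k$ of $D_k$, each concatenated three times; * *permutation matrix*: $L=N$, $c=1$, and $d_0,\dots,d_{N-1}$ are the rows of an arbitrary $N\times N$ permutation matrix. Given step sizes $a_n$, perturbation constants $\delta_n$ ($n\ge 0$), real random variables $\xi_{n,m}^{\pm}$ (measurement noises, $n\ge0$, $0\le m<L$) and an $\mathbb R^N$-valued random variable $x_0$ (possibly deterministic) on a probability space, the 1RDSA-DP iterates are $$x_{n+1}=x_n-a_n\widehat\nabla f(x_n),\qquad \widehat\nabla f(x_n)=c\sum_{m=0}^{L-1} d_m\,\frac{y_{n,m}^+-y_{n,m}^-}{2\,\delta_{nL+m}},\qquad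 y_{n,m}^{\pm}=f(x_n\pm\delta_{nL+m}d_m)+\xi_{n,m}^{\pm}.$$ Let $\mathcal F_n=\sigma(x_k,\ k\le n)$. **Theorem (Strong Convergence).** Assume: * (A1) $f$ is three times continuously differentiable, and there is $\alpha_0<\infty$ with $|\nabla^3_{i_1i_2i_3}f(x_n)|<\alpha_0$ a.s. for all $n$ and all $i_1,i_2,i_3$; * (A2) $\mathbb E[\xi_{n,m}^+-\xi_{n,m}^-\mid\mathcal F_n]=0$ a.s. for all $n\ge1$ and $0\le m<L$; * (A3) there is $\alpha_0>0$ with $\mathbb E|\xi_{n,m}^{\pm}|^2\le\alpha_0$ for all $n,m$; and for every $\delta>0$ there is $\alpha_1>0$ with $\mathbb E|f(x_n\pm\delta d_m)|^2\le\alpha_1$ for all $n,m$; * (A4) $a_n,\delta_n>0$ for all $n$, $a_n\to0$, $\delta_n\to0$, $\sum_n a_n=\infty$, and $\sum_n\left(\frac{a_n}{\delta_{nL+m}}\right)^2<\infty$ for each $m=0,\dots,L-1$; * (A5) $\sup_n\|x_n\|<\infty$ a.s. Let $x^*$ be an asymptotically stable equilibrium of the ODE $\dot x_t=-\nabla f(x_t)$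 (that is, $\nabla f(x^*)=0$, $x^*$ is Lyapunov stable, and a neighbourhood of $x^*$ is contained in $D(x^*)$), with domain of attraction $D(x^*)$, the set of all initial conditions from which the solution exists for all $t\ge0$ and converges to $x^*$ as $t\to\infty$. Suppose that there is a (deterministic) compact set $\mathcal D\subseteq D(x^*)$ such that, almost surely, $x_n\in\mathcal D$ for infinitely many $n$. Then, for either choice of perturbations, $$x_n\to x^*\quad\text{almost surely as } n\to\infty.$$ -/

import Mathlib

open MeasureTheory Filter
open scoped Topology

namespace RDSA

/-- `ℝ^N` with the Euclidean norm. -/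
abbrev Vec (N : ℕ) : Type := EuclideanSpace ℝ (Fin N)

/-- The `3^N × N` semi-lexicographic matrix `D_N`. The first column of `D_{k+1}` has
`2 * 3^k` entries `-1` followed by `3^k` entries `2`; the remaining columns are those of `D_k`,
each concatenated three times. (`D_0` is the empty `1 × 0` matrix, so that `D_1` has the single
column `(-1, -1, 2)`.) -/
noncomputable def semiLexMatrix : (N : ℕ) → Matrix (Fin (3 ^ N)) (Fin N) ℝ
  | 0 => fun _ i => i.elim0
  | k + 1 => fun m i =>
      Fin.cases (if (m : ℕ) < 2 * 3 ^ k then (-1 : ℝ) else 2)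
        (fun j => semiLexMatrix k ⟨(m : ℕ) % 3 ^ k, Nat.mod_lt _ (pow_pos three_pos k)⟩ j) i

/-- The two choices of deterministic perturbations in dimension `N`: the semi-lexicographic
sequence, or the rows of a permutation matrix. -/
inductive Scheme (N : ℕ) : Type
  | semiLex : Scheme N
  | perm (σ : Equiv.Perm (Fin N)) : Scheme N

/-- Length `P + 1` of the inner loop: `3^N` resp. `N`. -/
def Scheme.len {N : ℕ} : Scheme N → ℕ
  | .semiLex => 3 ^ N
  | .perm _ => N

/-- The matrix whose rows are the perturbations `d_0, …, d_P`. -/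
noncomputable def Scheme.matrix {N : ℕ} : (S : Scheme N) → Matrix (Fin S.len) (Fin N) ℝ
  | .semiLex => semiLexMatrix N
  | .perm σ => σ.permMatrix ℝ

/-- The perturbation vector `d_m`. -/
noncomputable def Scheme.dir {N : ℕ} (S : Scheme N) (m : Fin S.len) : Vec N :=
  WithLp.toLp 2 (S.matrix m)

/-- The factor in front of `∑ g_m`: `1 / (2 * 3^N)` resp. `1`. -/
noncomputable def Scheme.factor {N : ℕ} : Scheme N → ℝ
  | .semiLex => 1 / (2 * 3 ^ N)
  | .perm _ => 1

/-- The gradient estimate in outer iteration `n` at the point `x`, where `δ` is the sequence of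
perturbation constants and `ep m`, `em m` are the values of the measurement noises
`ξ_m^+`, `ξ_m^-` in this iteration. -/
noncomputable def gradEst {N : ℕ} (S : Scheme N) (f : Vec N → ℝ) (δ : ℕ → ℝ) (n : ℕ) (x : Vec N)
    (ep em : Fin S.len → ℝ) : Vec N :=
  S.factor • ∑ m : Fin S.len,
    (((f (x + δ (n * S.len + m) • S.dir m) + ep m) - (f (x - δ (n * S.len + m) • S.dir m) + em m))
      / (2 * δ (n * S.len + m))) • S.dir m

/-- The σ-algebra `F_n = σ(x_k, k ≤ n)`. -/
@[reducible] def history {N : ℕ} {Ω : Type*} (x : ℕ → Ω → Vec N) (n : ℕ) : MeasurableSpace Ω :=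
  ⨆ k ≤ n, MeasurableSpace.comap (x k) inferInstance

/-- `y` solves `y' = -∇f(y)` on `[0, ∞)` with `y 0 = x₀`. -/
def IsGradientFlow {N : ℕ} (f : Vec N → ℝ) (x₀ : Vec N) (y : ℝ → Vec N) : Prop :=
  y 0 = x₀ ∧ ∀ t, 0 ≤ t → HasDerivWithinAt y (-gradient f (y t)) (Set.Ici 0) t

/-- The domain of attraction: all `x₀` from which the solution of `y' = -∇f(y)` exists for all
times `t ≥ 0` and converges to `xs` (for a `C²` function `f` the solution is unique). -/
def attractionDomain {N : ℕ} (f : Vec N → ℝ) (xs : Vec N) : Set (Vec N) :=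
  {x₀ | ∃ y, IsGradientFlow f x₀ y ∧ Tendsto y atTop (𝓝 xs)}

/-- `xs` is an asymptotically stable equilibrium of `y' = -∇f(y)`: an equilibrium that is
stable in the sense of Lyapunov and attracts a neighbourhood. -/
structure IsAsymptoticallyStable {N : ℕ} (f : Vec N → ℝ) (xs : Vec N) : Prop where
  equilibrium : gradient f xs = 0
  stable : ∀ ε > 0, ∃ r > 0, ∀ x₀, dist x₀ xs < r → ∀ y, IsGradientFlow f x₀ y →
    ∀ t, 0 ≤ t → dist (y t) xs < ε
  attractive : ∃ r > 0, Metric.ball xs r ⊆ attractionDomain f xs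

end RDSA

/-! Fix a sample path. Both perturbation families satisfy c ∑ d_m d_mᵀ = I
(`Scheme.factor_mul_sum`), so the noise-free estimate is ∇f(x_n) plus a bias that vanishes with δ_n
(`tendsto_gradEst_sub`). The noise contributions w_n, already multiplied by a_n, are martingale
differences from n = 1 on with summable second moments, so ∑ w_n converges almost surely. Adding the
error of its partial sums to x_n gives a sequence z_n with z_n - x_n → 0 that is an Euler scheme for
the gradient flow with vanishing perturbations.

Recurrence to the compact set gives a cluster point p of x_n attracted to x*. Over any finite time
the scheme started near p shadows the flow from p (`exists_euler_near_flow`), so z_n comes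
arbitrarily close to x* infinitely often. Since f decreases strictly along nonconstant trajectories,
asymptotic stability makes x* a strict local minimum with no other critical point nearby
(`IsAsymptoticallyStable.exists_strict_min`). Then f serves as a Lyapunov function that traps z_n
near x* (`tendsto_of_frequently_near`). -/

namespace RDSA

/-! ### Perturbed Euler schemes shadow the flow on finite time intervals -/

section Euler

variable {E : Type*} [NormedAddCommGroup E] [NormedSpace ℝ E]

/-- Local error of one Euler step for a solution of `y' = -G(y)` that stays in a set on which `G`
is Lipschitz and bounded. -/
theorem norm_euler_local_error_le {G : E → E} {L : NNReal} {M T : ℝ} {s : Set E}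
    (hG : LipschitzOnWith L G s) (hM : ∀ u ∈ s, ‖G u‖ ≤ M) {y : ℝ → E}
    (hy : ∀ t, 0 ≤ t → HasDerivWithinAt y (-G (y t)) (Set.Ici 0) t)
    (hys : ∀ t ∈ Set.Icc 0 T, y t ∈ s) {t h : ℝ} (ht : 0 ≤ t) (hh : 0 ≤ h) (hT : t + h ≤ T) :
    ‖y (t + h) - y t + h • G (y t)‖ ≤ L * M * h * h := by
  have hsub : Set.Icc t (t + h) ⊆ Set.Ici 0 := fun u hu => ht.trans hu.1
  have hmem : ∀ u ∈ Set.Icc t (t + h), y u ∈ s := fun u hu =>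
    hys u ⟨ht.trans hu.1, hu.2.trans hT⟩
  have htm : t ∈ Set.Icc t (t + h) := ⟨le_rfl, by linarith⟩
  have htm' : t + h ∈ Set.Icc t (t + h) := ⟨by linarith, le_rfl⟩
  have hd : ∀ u ∈ Set.Icc t (t + h), HasDerivWithinAt y (-G (y u)) (Set.Icc t (t + h)) u :=
    fun u hu => (hy u (hsub hu)).mono hsub
  have hM0 : 0 ≤ M := (norm_nonneg _).trans (hM _ (hmem t htm))
  have hlip : ∀ u ∈ Set.Icc t (t + h), ‖y u - y t‖ ≤ M * h := fun u hu => by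
    have := (convex_Icc t (t + h)).norm_image_sub_le_of_norm_hasDerivWithin_le hd
      (fun v hv => by rw [norm_neg]; exact hM _ (hmem v hv)) htm hu
    refine this.trans ?_
    gcongr
    rw [Real.norm_eq_abs, abs_of_nonneg (by linarith [hu.1])]
    linarith [hu.2]
  -- The linear term cancels the velocity at time t, so the derivative is G (y t) - G (y u), of norm
  -- at most L * (M * h).
  have hd2 : ∀ u ∈ Set.Icc t (t + h),
      HasDerivWithinAt (fun v => y v + v • G (y t)) (-G (y u) + (1 : ℝ) • G (y t))
        (Set.Icc t (t + h)) u := fun u hu =>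
    (hd u hu).add ((hasDerivWithinAt_id u _).smul_const _)
  have := (convex_Icc t (t + h)).norm_image_sub_le_of_norm_hasDerivWithin_le hd2
    (C := L * M * h) (fun u hu => ?_) htm htm'
  · rw [add_sub_cancel_left, Real.norm_eq_abs, abs_of_nonneg hh] at this
    refine le_trans (le_of_eq ?_) this
    congr 1
    rw [add_smul]
    abel
  · rw [one_smul, neg_add_eq_sub, norm_sub_rev]
    have := hG.norm_sub_le (hmem u hu) (hmem t htm)
    rw [mul_assoc]
    exact this.trans (mul_le_mul_of_nonneg_left (hlip u hu) L.2)

/-- Discrete Grönwall inequality with variable step sizes. -/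
theorem le_exp_of_le_one_add_mul {L β : ℝ} (hL : 0 ≤ L) (hβ : 0 ≤ β) {a e : ℕ → ℝ} {J : ℕ}
    (ha : ∀ n, 0 ≤ a n) (he0 : 0 ≤ e 0)
    (he : ∀ j < J, e (j + 1) ≤ (1 + a j * L) * e j + a j * β) :
    ∀ j ≤ J, e j ≤ (e 0 + β * ∑ i ∈ Finset.range j, a i) *
      Real.exp (L * ∑ i ∈ Finset.range j, a i) := by
  intro j
  induction j with
  | zero => simp
  | succ j ih =>
    intro hj
    have ih := ih (by omega)
    have hs : 0 ≤ ∑ i ∈ Finset.range j, a i := Finset.sum_nonneg fun i _ => ha i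
    rw [Finset.sum_range_succ]
    set t := ∑ i ∈ Finset.range j, a i
    have h1 : 1 + a j * L ≤ Real.exp (L * a j) := by
      have := Real.add_one_le_exp (L * a j); linarith
    have h2 : 1 ≤ Real.exp (L * (t + a j)) :=
      Real.one_le_exp (mul_nonneg hL (add_nonneg hs (ha j)))
    calc e (j + 1) ≤ (1 + a j * L) * e j + a j * β := he j (by omega)
      _ ≤ Real.exp (L * a j) * ((e 0 + β * t) * Real.exp (L * t))
          + a j * β * Real.exp (L * (t + a j)) := by
          have h0 : 0 ≤ 1 + a j * L := by have := mul_nonneg (ha j) hL; linarith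
          have h3 : 0 ≤ (e 0 + β * t) * Real.exp (L * t) := by positivity
          have h4 : 0 ≤ a j * β := mul_nonneg (ha j) hβ
          exact add_le_add ((mul_le_mul_of_nonneg_left ih h0).trans
            (mul_le_mul_of_nonneg_right h1 h3)) (le_mul_of_one_le_right h4 h2)
      _ = _ := by rw [mul_add, Real.exp_add]; ring

/-- A perturbed Euler scheme with vanishing steps and perturbations follows a solution of
`y' = -G(y)` over a time interval of any prescribed length. -/
theorem exists_euler_near_flow {G : E → E} {L : NNReal} {M T : ℝ} {s : Set E}
    (hG : LipschitzOnWith L G s) (hM : ∀ u ∈ s, ‖G u‖ ≤ M) {y : ℝ → E}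
    (hy : ∀ t, 0 ≤ t → HasDerivWithinAt y (-G (y t)) (Set.Ici 0) t) (hT : 0 ≤ T)
    (hys : ∀ t ∈ Set.Icc 0 (T + 1), y t ∈ s) {a : ℕ → ℝ} {z b : ℕ → E}
    (hz : ∀ n, z (n + 1) = z n - a n • (G (z n) + b n)) (hzs : ∀ n, z n ∈ s)
    (hb : Tendsto b atTop (𝓝 0)) (ha : Tendsto a atTop (𝓝 0)) (ha_pos : ∀ n, 0 < a n)
    (ha_sum : Tendsto (fun n => ∑ k ∈ Finset.range n, a k) atTop atTop) {ε : ℝ} (hε : 0 < ε) :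
    ∃ ρ > 0, ∀ᶠ n in atTop, ‖z n - y 0‖ < ρ →
      ∃ k ≥ n, ∃ t ≥ T, ‖z k - y t‖ < ε := by
  have hM0 : 0 ≤ M := (norm_nonneg _).trans (hM _ (hzs 0))
  -- D is the Grönwall amplification over time T + 1. With β bounding both the initial distance and
  -- the error per unit time, the final error is at most β * D = ε / 2.
  set D := (1 + (T + 1)) * Real.exp (L * (T + 1)) with hD
  have hDpos : 0 < D := by positivity
  set β := ε / (2 * D) with hβ
  have hβpos : 0 < β := by positivity
  refine ⟨β, hβpos, ?_⟩
  have hlim : Tendsto (fun n => ‖b n‖ + L * M * a n) atTop (𝓝 0) := by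
    simpa using hb.norm.add (ha.const_mul (L * M))
  obtain ⟨n₀, hn₀⟩ := eventually_atTop.1
    ((hlim.eventually_lt_const hβpos).and (ha.eventually_lt_const one_pos))
  filter_upwards [eventually_ge_atTop n₀] with n hn hclose
  set t : ℕ → ℝ := fun j => ∑ i ∈ Finset.range j, a (n + i) with ht
  have htt : Tendsto t atTop atTop := by
    have h1 : Tendsto (fun j => ∑ k ∈ Finset.range (n + j), a k) atTop atTop :=
      ha_sum.comp (tendsto_add_atTop_nat n |>.congr fun j => add_comm _ _)
    have h2 : t = fun j => (∑ k ∈ Finset.range (n + j), a k) + -∑ k ∈ Finset.range n, a k := by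
      funext j
      rw [Finset.sum_range_add]
      simp [ht]
    rw [h2]
    exact tendsto_atTop_add_const_right _ _ h1
  have htsucc : ∀ j, t (j + 1) = t j + a (n + j) := fun j => Finset.sum_range_succ _ _
  have hex : ∃ j, T ≤ t j := (htt.eventually_ge_atTop T).exists
  classical
  set J := Nat.find hex with hJ
  have hJT : T ≤ t J := Nat.find_spec hex
  have ht0 : ∀ j, 0 ≤ t j := fun j => Finset.sum_nonneg fun i _ => (ha_pos _).le
  -- Steps are shorter than 1, so the first grid time beyond T overshoots by less than 1.
  have htJ : ∀ j ≤ J, t j ≤ T + 1 := by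
    intro j hj
    cases j with
    | zero => simp only [ht, Finset.range_zero, Finset.sum_empty]; linarith
    | succ j =>
      have := Nat.find_min hex (m := j) (by omega)
      have := (hn₀ (n + j) (by omega)).2
      rw [htsucc]
      linarith
  have hgr := le_exp_of_le_one_add_mul (L := L) (β := β) L.2 hβpos.le (a := fun j => a (n + j))
    (e := fun j => ‖z (n + j) - y (t j)‖) (J := J) (fun j => (ha_pos _).le) (norm_nonneg _)
    (fun j hj => ?_) J le_rfl
  · refine ⟨n + J, by omega, t J, hJT, hgr.trans_lt ?_⟩
    change (‖z (n + 0) - y (t 0)‖ + β * t J) * Real.exp (L * t J) < ε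
    have h0 : ‖z (n + 0) - y (t 0)‖ < β := by simpa [ht] using hclose
    have h1 := htJ J le_rfl
    calc (‖z (n + 0) - y (t 0)‖ + β * t J) * Real.exp (L * t J)
        ≤ (β + β * (T + 1)) * Real.exp (L * (T + 1)) := by gcongr
      _ = β * D := by rw [hD]; ring
      _ = ε / 2 := by rw [hβ]; field_simp
      _ < ε := by linarith
  · have hj1 : t (j + 1) ≤ T + 1 := htJ (j + 1) (by omega)
    have hja : 0 ≤ a (n + j) := (ha_pos _).le
    have hloc := norm_euler_local_error_le hG hM hy hys (ht0 j) hja (by rw [← htsucc]; exact hj1)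
    have hyj : y (t j) ∈ s := hys _ ⟨ht0 j, htJ j (by omega)⟩
    have hlip := hG.norm_sub_le (hzs (n + j)) hyj
    have hbj := (hn₀ (n + j) (by omega)).1
    change ‖z (n + j + 1) - y (t (j + 1))‖ ≤ (1 + a (n + j) * L) * ‖z (n + j) - y (t j)‖
      + a (n + j) * β
    rw [hz, htsucc]
    set α := a (n + j)
    have key : z (n + j) - α • (G (z (n + j)) + b (n + j)) - y (t j + α)
        = (z (n + j) - y (t j)) - α • (G (z (n + j)) - G (y (t j)))
          - α • b (n + j) - (y (t j + α) - y (t j) + α • G (y (t j))) := by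
      simp only [smul_add, smul_sub]
      abel
    rw [key]
    have h1 : ‖α • (G (z (n + j)) - G (y (t j)))‖ ≤ α * (L * ‖z (n + j) - y (t j)‖) := by
      rw [norm_smul, Real.norm_of_nonneg hja]; gcongr
    have h2 : ‖α • b (n + j)‖ = α * ‖b (n + j)‖ := by
      rw [norm_smul, Real.norm_of_nonneg hja]
    have h3 : α * (‖b (n + j)‖ + L * M * α) ≤ α * β := by gcongr
    have h4 := norm_sub_le ((z (n + j) - y (t j)) - α • (G (z (n + j)) - G (y (t j)))
          - α • b (n + j)) (y (t j + α) - y (t j) + α • G (y (t j)))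
    have h5 := norm_sub_le ((z (n + j) - y (t j)) - α • (G (z (n + j)) - G (y (t j))))
          (α • b (n + j))
    have h6 := norm_sub_le (z (n + j) - y (t j)) (α • (G (z (n + j)) - G (y (t j))))
    nlinarith [h1, h2, h3, h4, h5, h6, hloc]

end Euler

/-! ### The objective as a Lyapunov function -/

section Lyapunov

variable {E : Type*} [NormedAddCommGroup E] [InnerProductSpace ℝ E]

/-- A function with continuous gradient is differentiable uniformly on bounded sets. -/
theorem exists_abs_sub_sub_inner_le [ProperSpace E] {f : E → ℝ} {G : E → E}
    (hf : ∀ u, HasFDerivAt f (innerSL ℝ (G u)) u) (hG : Continuous G) (R : ℝ) {η : ℝ} (hη : 0 < η) :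
    ∃ h > 0, ∀ u v, ‖u‖ ≤ R → ‖v‖ ≤ R → ‖v - u‖ < h →
      |f v - f u - inner ℝ (G u) (v - u)| ≤ η * ‖v - u‖ := by
  have huc := (isCompact_closedBall (0 : E) R).uniformContinuousOn_of_continuous hG.continuousOn
  rw [Metric.uniformContinuousOn_iff] at huc
  obtain ⟨h, hh, H⟩ := huc η hη
  refine ⟨h, hh, fun u v hu hv huv => ?_⟩
  have hconv : Convex ℝ (Metric.closedBall (0 : E) R ∩ Metric.ball u h) :=
    (convex_closedBall _ _).inter (convex_ball _ _)
  have hu' : u ∈ Metric.closedBall (0 : E) R := by simpa using hu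
  have hv' : v ∈ Metric.closedBall (0 : E) R := by simpa using hv
  have := hconv.norm_image_sub_le_of_norm_hasFDerivWithin_le' (f := f)
    (f' := fun w => innerSL ℝ (G w)) (φ := innerSL ℝ (G u)) (C := η)
    (fun w _ => (hf w).hasFDerivWithinAt)
    (fun w hw => by
      rw [← map_sub, innerSL_apply_norm, ← dist_eq_norm]
      exact (H w hw.1 u hu' hw.2).le)
    ⟨hu', Metric.mem_ball_self hh⟩ ⟨hv', by rwa [Metric.mem_ball, dist_eq_norm]⟩
  simpa [Real.norm_eq_abs] using this

/-- Descent along a perturbed gradient scheme. -/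
theorem eventually_descent [ProperSpace E] {f : E → ℝ} {G : E → E}
    (hf : ∀ u, HasFDerivAt f (innerSL ℝ (G u)) u) (hG : Continuous G) {R M : ℝ}
    (hM : ∀ u, ‖u‖ ≤ R → ‖G u‖ ≤ M) {a : ℕ → ℝ} {z b : ℕ → E}
    (hz : ∀ n, z (n + 1) = z n - a n • (G (z n) + b n)) (hzR : ∀ n, ‖z n‖ ≤ R)
    (hb : Tendsto b atTop (𝓝 0)) (ha : Tendsto a atTop (𝓝 0)) (ha_pos : ∀ n, 0 < a n)
    {κ : ℝ} (hκ : 0 < κ) :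
    ∀ᶠ n in atTop, f (z (n + 1)) ≤ f (z n) - a n * (‖G (z n)‖ ^ 2 - κ) ∧
      ‖z (n + 1) - z n‖ ≤ a n * (M + 1) := by
  have hM0 : 0 ≤ M := (norm_nonneg _).trans (hM _ (hzR 0))
  -- The linearisation error and the perturbation term each use up half of κ.
  set η := κ / (2 * (M + 1)) with hη
  have hη0 : 0 < η := by positivity
  obtain ⟨h, hh, H⟩ := exists_abs_sub_sub_inner_le hf hG R hη0
  have hb1 : Tendsto (fun n => ‖b n‖) atTop (𝓝 0) := by simpa using hb.norm
  have hb2 : Tendsto (fun n => M * ‖b n‖) atTop (𝓝 0) := by simpa using hb1.const_mul M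
  have ha2 : Tendsto (fun n => a n * (M + 1)) atTop (𝓝 0) := by simpa using ha.mul_const (M + 1)
  filter_upwards [hb1.eventually_lt_const one_pos, hb2.eventually_lt_const (half_pos hκ),
    ha2.eventually_lt_const hh] with n h1 h2 h3
  have hstep : z (n + 1) - z n = -(a n • (G (z n) + b n)) := by rw [hz]; abel
  have hnorm : ‖z (n + 1) - z n‖ ≤ a n * (M + 1) := by
    rw [hstep, norm_neg, norm_smul, Real.norm_of_nonneg (ha_pos n).le]
    have := norm_add_le (G (z n)) (b n)
    have := hM _ (hzR n)
    have := ha_pos n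
    gcongr
    linarith
  refine ⟨?_, hnorm⟩
  have hle := (abs_le.1 (H (z n) (z (n + 1)) (hzR _) (hzR _) (hnorm.trans_lt h3))).2
  have hin : inner ℝ (G (z n)) (z (n + 1) - z n)
      = -(a n * (‖G (z n)‖ ^ 2 + inner ℝ (G (z n)) (b n))) := by
    rw [hstep, inner_neg_right, inner_smul_right, inner_add_right, real_inner_self_eq_norm_sq]
  have hcs : -inner ℝ (G (z n)) (b n) ≤ κ / 2 := by
    have h5 := (abs_le.1 (abs_real_inner_le_norm (G (z n)) (b n))).1
    have h6 : ‖G (z n)‖ * ‖b n‖ ≤ M * ‖b n‖ := by gcongr; exact hM _ (hzR n)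
    linarith
  have h7 : η * ‖z (n + 1) - z n‖ ≤ a n * (κ / 2) := by
    calc η * ‖z (n + 1) - z n‖ ≤ η * (a n * (M + 1)) := by gcongr
      _ = a n * (κ / 2) := by rw [hη]; field_simp
  have h8 := mul_le_mul_of_nonneg_left hcs (ha_pos n).le
  rw [hin] at hle
  linarith

/-- A perturbed gradient scheme that clusters at a strict local minimum isolated among the critical
points converges to it. -/
theorem tendsto_of_frequently_near [ProperSpace E] {f : E → ℝ} {G : E → E}
    (hf : ∀ u, HasFDerivAt f (innerSL ℝ (G u)) u) (hG : Continuous G) {R : ℝ}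
    {a : ℕ → ℝ} {z b : ℕ → E}
    (hz : ∀ n, z (n + 1) = z n - a n • (G (z n) + b n)) (hzR : ∀ n, ‖z n‖ ≤ R)
    (hb : Tendsto b atTop (𝓝 0)) (ha : Tendsto a atTop (𝓝 0)) (ha_pos : ∀ n, 0 < a n)
    {xs : E} {r : ℝ} (hr : 0 < r)
    (hmin : ∀ u, dist u xs < r → u ≠ xs → f xs < f u ∧ G u ≠ 0)
    (hfreq : ∀ ε > 0, ∃ᶠ n in atTop, dist (z n) xs < ε) :
    Tendsto z atTop (𝓝 xs) := by
  obtain ⟨M, hM⟩ := (isCompact_closedBall (0 : E) R).exists_bound_of_continuousOn hG.continuousOn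
  replace hM : ∀ u, ‖u‖ ≤ R → ‖G u‖ ≤ M := fun u hu => hM u (by simpa using hu)
  have hfc : Continuous f := continuous_iff_continuousAt.2 fun u => (hf u).continuousAt
  rw [Metric.tendsto_atTop']
  suffices H : ∀ ε > 0, ε < r → ∀ᶠ n in atTop, dist (z n) xs < ε by
    intro ε hε
    obtain ⟨n, hn⟩ := eventually_atTop.1 (H (min ε (r / 2)) (by positivity)
      ((min_le_right _ _).trans_lt (by linarith)))
    exact ⟨n, fun k hk => (hn k hk.le).trans_le (min_le_left _ _)⟩
  intro ε hε hεr
  have hcb := isCompact_closedBall xs ε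
  have hA : IsCompact (Metric.closedBall xs ε ∩ {u | ε / 2 ≤ dist u xs}) :=
    hcb.inter_right (isClosed_le continuous_const (continuous_id.dist continuous_const))
  obtain ⟨c', hc', hAc⟩ := hA.exists_forall_le' hfc.continuousOn (a := f xs) (fun u hu =>
    (hmin u ((Metric.mem_closedBall.1 hu.1).trans_lt hεr) (fun h => by
      have := hu.2; simp only [Set.mem_ofPred_eq, h, dist_self] at this; linarith)).1)
  -- f ≥ c' on the annulus between ε / 2 and ε. The level c leaves room below c': where f ≥ c the
  -- squared gradient norm is at least κ and a step cannot raise f; where f < c a step raises f by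
  -- at most a n * κ < c' - c.
  set c := (f xs + c') / 2 with hc
  have hB : IsCompact (Metric.closedBall xs ε ∩ {u | c ≤ f u}) :=
    hcb.inter_right (isClosed_le continuous_const hfc)
  obtain ⟨κ, hκ, hBκ⟩ := hB.exists_forall_le' (f := fun u => ‖G u‖ ^ 2)
    (hG.norm.pow 2).continuousOn (a := 0) (fun u hu => by
      have hne : G u ≠ 0 := (hmin u ((Metric.mem_closedBall.1 hu.1).trans_lt hεr) (fun h => by
        have := hu.2; simp only [Set.mem_ofPred_eq, h] at this; linarith)).2
      positivity)
  have ha1 : Tendsto (fun n => a n * κ) atTop (𝓝 0) := by simpa using ha.mul_const κ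
  have ha2 : Tendsto (fun n => a n * (M + 1)) atTop (𝓝 0) := by simpa using ha.mul_const (M + 1)
  obtain ⟨n₀, hn₀⟩ := eventually_atTop.1 ((eventually_descent hf hG hM hz hzR hb ha ha_pos hκ).and
    ((ha1.eventually_lt_const (show 0 < c' - c by linarith)).and
      (ha2.eventually_lt_const (half_pos hε))))
  have hinv : ∀ n ≥ n₀, dist (z n) xs < ε / 2 → f (z n) < c' →
      dist (z (n + 1)) xs < ε / 2 ∧ f (z (n + 1)) < c' := by
    intro n hn h1 h2
    obtain ⟨⟨hd, hs⟩, hκn, hMn⟩ := hn₀ n hn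
    have hball : dist (z (n + 1)) xs ≤ ε := by
      have := dist_triangle (z (n + 1)) (z n) xs
      rw [dist_eq_norm (z (n + 1)) (z n)] at this
      linarith
    have hlt : f (z (n + 1)) < c' := by
      by_cases hcn : c ≤ f (z n)
      · have := hBκ (z n) ⟨Metric.mem_closedBall.2 (by linarith), hcn⟩
        have := mul_nonneg (ha_pos n).le (sub_nonneg.2 this)
        linarith
      · have := mul_nonneg (ha_pos n).le (sq_nonneg ‖G (z n)‖)
        push Not at hcn
        linarith
    -- A step shorter than ε / 2 cannot jump over the annulus, and f < c' forbids landing in it.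
    refine ⟨?_, hlt⟩
    by_contra hge
    exact absurd (hAc _ ⟨Metric.mem_closedBall.2 hball, not_lt.1 hge⟩) (not_le.2 hlt)
  obtain ⟨ρ, hρ, hρf⟩ := Metric.continuousAt_iff.1 hfc.continuousAt (c' - f xs) (sub_pos.2 hc')
  obtain ⟨n, hn, hzn⟩ := frequently_atTop.1 (hfreq (min ρ (ε / 2)) (by positivity)) n₀
  have hstart : f (z n) < c' := by
    have := hρf (hzn.trans_le (min_le_left _ _))
    rw [Real.dist_eq] at this
    linarith [(abs_lt.1 this).2]
  have hall : ∀ k ≥ n, dist (z k) xs < ε / 2 ∧ f (z k) < c' := by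
    intro k hk
    induction k, hk using Nat.le_induction with
    | base => exact ⟨hzn.trans_le (min_le_right _ _), hstart⟩
    | succ k hk ih => exact hinv k (hn.trans hk) ih.1 ih.2
  exact eventually_atTop.2 ⟨n, fun k hk => (hall k hk).1.trans (by linarith)⟩

/-- A solution of `y' = -G(y)` that starts at a zero of a locally Lipschitz `G` is constant. -/
theorem flow_eq_of_zero {G : E → E} (hG : ∀ R, ∃ L : NNReal, LipschitzOnWith L G
    (Metric.closedBall 0 R)) {y : ℝ → E}
    (hy : ∀ t, 0 ≤ t → HasDerivWithinAt y (-G (y t)) (Set.Ici 0) t) (h0 : G (y 0) = 0)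
    {T : ℝ} (hT : 0 ≤ T) : y T = y 0 := by
  have hc : ContinuousOn y (Set.Icc 0 T) := fun t ht =>
    ((hy t ht.1).mono Set.Icc_subset_Ici_self).continuousWithinAt
  obtain ⟨R, hR⟩ := isCompact_Icc.exists_bound_of_continuousOn hc
  obtain ⟨L, hL⟩ := hG R
  refine ODE_solution_unique_of_mem_Icc_right (v := fun _ u => -G u) (K := L)
    (s := fun _ => Metric.closedBall 0 R) (f := y) (g := fun _ => y 0) (a := 0) (b := T)
    (fun t _ => hL.neg) hc (fun t ht => (hy t ht.1).mono (Set.Ici_subset_Ici.2 ht.1))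
    (fun t ht => by simpa using hR t ⟨ht.1, ht.2.le⟩) continuousOn_const
    (fun t _ => by simpa [h0] using hasDerivWithinAt_const t (Set.Ici t) (y 0))
    (fun t _ => by simpa using hR 0 ⟨le_rfl, hT⟩) rfl ⟨hT, le_rfl⟩

/-- A point that is attracted to `xs` by the gradient flow and differs from `xs` is not critical and
has a larger value of the objective. -/
theorem lt_and_ne_zero_of_flow_tendsto {f : E → ℝ} {G : E → E}
    (hf : ∀ u, HasFDerivAt f (innerSL ℝ (G u)) u) (hG : ∀ R, ∃ L : NNReal, LipschitzOnWith L G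
    (Metric.closedBall 0 R)) {y : ℝ → E} {xs : E}
    (hy : ∀ t, 0 ≤ t → HasDerivWithinAt y (-G (y t)) (Set.Ici 0) t)
    (hlim : Tendsto y atTop (𝓝 xs)) (hne : y 0 ≠ xs) : f xs < f (y 0) ∧ G (y 0) ≠ 0 := by
  have hG0 : G (y 0) ≠ 0 := fun h => hne <| by
    refine tendsto_nhds_unique (tendsto_const_nhds.congr' ?_) hlim
    filter_upwards [eventually_ge_atTop 0] with t ht
    exact (flow_eq_of_zero hG hy h ht).symm
  refine ⟨?_, hG0⟩
  -- Otherwise f, nonincreasing along y with limit f xs ≥ f (y 0), is constant along y, and its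
  -- derivative -‖G (y 0)‖ ^ 2 at time 0 vanishes.
  by_contra hle
  push Not at hle
  have hder : ∀ t, 0 ≤ t → HasDerivWithinAt (fun t => f (y t)) (-‖G (y t)‖ ^ 2) (Set.Ici 0) t := by
    intro t ht
    exact ((hf (y t)).comp_hasDerivWithinAt t (hy t ht)).congr_deriv
      (by simp)
  have hanti : AntitoneOn (fun t => f (y t)) (Set.Ici 0) :=
    antitoneOn_of_hasDerivWithinAt_nonpos (convex_Ici 0)
      (fun t ht => (hder t ht).continuousWithinAt)
      (fun t ht => (hder t (interior_subset ht)).mono interior_subset)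
      (fun t _ => by simp)
  have hflim : Tendsto (fun t => f (y t)) atTop (𝓝 (f xs)) :=
    ((hf xs).continuousAt.tendsto).comp hlim
  have hconst : ∀ t ∈ Set.Ici (0 : ℝ), f (y t) = f (y 0) := fun t ht => by
    refine le_antisymm (hanti Set.self_mem_Ici ht ht) (hle.trans ?_)
    refine le_of_tendsto hflim ?_
    filter_upwards [eventually_ge_atTop t] with u hu
    exact hanti ht (ht.trans hu) hu
  have h1 := (hasDerivWithinAt_const (0 : ℝ) (Set.Ici (0 : ℝ)) (f (y 0))).congr hconst rfl
  have h2 := (uniqueDiffOn_Ici (0 : ℝ) 0 Set.self_mem_Ici).eq_deriv _ (hder 0 le_rfl) h1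
  exact hG0 (by simpa using h2)

end Lyapunov

/-! ### Orthogonality of the perturbation matrices -/

section Scheme

theorem semiLexMatrix_succ_zero {k : ℕ} (m : Fin (3 ^ (k + 1))) :
    semiLexMatrix (k + 1) m 0 = if (m : ℕ) < 2 * 3 ^ k then (-1 : ℝ) else 2 := rfl

theorem semiLexMatrix_succ_succ {k : ℕ} (m : Fin (3 ^ (k + 1))) (j : Fin k) :
    semiLexMatrix (k + 1) m j.succ =
      semiLexMatrix k ⟨(m : ℕ) % 3 ^ k, Nat.mod_lt _ (pow_pos three_pos k)⟩ j := rfl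

/-- The indices of the `3 ^ (k + 1)` rows split into three blocks of length `3 ^ k`. -/
theorem sum_fin_three_pow_succ {k : ℕ} (g : Fin 3 → Fin (3 ^ k) → ℝ)
    (F : Fin (3 ^ (k + 1)) → ℝ)
    (hF : ∀ (q : Fin 3) (r : Fin (3 ^ k)) (m : Fin (3 ^ (k + 1))),
      (m : ℕ) = r + 3 ^ k * q → F m = g q r) :
    ∑ m, F m = ∑ q, ∑ r, g q r := by
  have h : 3 * 3 ^ k = 3 ^ (k + 1) := by ring
  rw [← Fintype.sum_prod_type' g]
  refine (Fintype.sum_equiv (finProdFinEquiv.trans (finCongr h)) _ _ fun p => ?_).symm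
  exact (hF p.1 p.2 _ (by simp [finProdFinEquiv])).symm

/-- The leading base-three digit q of the row index determines the first column; the remaining
digits r determine the other columns. -/
theorem semiLexMatrix_block_zero {k : ℕ} (q : Fin 3) (r : Fin (3 ^ k)) (m : Fin (3 ^ (k + 1)))
    (hm : (m : ℕ) = r + 3 ^ k * q) :
    semiLexMatrix (k + 1) m 0 = (![-1, -1, 2] : Fin 3 → ℝ) q := by
  rw [semiLexMatrix_succ_zero, hm]
  have := r.2
  fin_cases q
  · rw [if_pos (by simp; omega)]; rfl
  · rw [if_pos (by simp; omega)]; rfl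
  · rw [if_neg (by simp; omega)]; rfl

theorem semiLexMatrix_block_succ {k : ℕ} (q : Fin 3) (r : Fin (3 ^ k)) (m : Fin (3 ^ (k + 1)))
    (hm : (m : ℕ) = r + 3 ^ k * q) (j : Fin k) :
    semiLexMatrix (k + 1) m j.succ = semiLexMatrix k r j := by
  rw [semiLexMatrix_succ_succ]
  congr 1
  ext
  simp [hm, Nat.mod_eq_of_lt r.2]

/-- The entries -1, -1, 2 balance. Since the first column is constant on blocks that repeat the
smaller matrix, this makes it orthogonal to the others. -/
theorem sum_semiLexMatrix {k : ℕ} (j : Fin k) : ∑ m, semiLexMatrix k m j = 0 := by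
  induction k with
  | zero => exact j.elim0
  | succ k ih =>
    cases j using Fin.cases with
    | zero =>
      rw [sum_fin_three_pow_succ (fun q _ => (![-1, -1, 2] : Fin 3 → ℝ) q) _
        semiLexMatrix_block_zero]
      simp [Fin.sum_univ_three]
      ring
    | succ j =>
      rw [sum_fin_three_pow_succ (fun _ r => semiLexMatrix k r j) _
        (fun q r m hm => semiLexMatrix_block_succ q r m hm j)]
      simp [ih]

/-- The columns of the semi-lexicographic matrix are orthogonal, with squared norm `2 * 3 ^ k`. -/
theorem sum_semiLexMatrix_mul {k : ℕ} (i j : Fin k) :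
    ∑ m, semiLexMatrix k m i * semiLexMatrix k m j = if i = j then 2 * 3 ^ k else 0 := by
  induction k with
  | zero => exact j.elim0
  | succ k ih =>
    cases i using Fin.cases with
    | zero =>
      cases j using Fin.cases with
      | zero =>
        rw [sum_fin_three_pow_succ
          (fun q _ => (![-1, -1, 2] : Fin 3 → ℝ) q * (![-1, -1, 2] : Fin 3 → ℝ) q) _
          (fun q r m hm => by rw [semiLexMatrix_block_zero q r m hm])]
        simp [Fin.sum_univ_three]
        ring
      | succ j =>
        rw [sum_fin_three_pow_succ
          (fun q r => (![-1, -1, 2] : Fin 3 → ℝ) q * semiLexMatrix k r j) _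
          (fun q r m hm => by
            rw [semiLexMatrix_block_zero q r m hm, semiLexMatrix_block_succ q r m hm])]
        simp [← Finset.mul_sum, sum_semiLexMatrix, (Fin.succ_ne_zero j).symm]
    | succ i =>
      cases j using Fin.cases with
      | zero =>
        rw [sum_fin_three_pow_succ
          (fun q r => semiLexMatrix k r i * (![-1, -1, 2] : Fin 3 → ℝ) q) _
          (fun q r m hm => by
            rw [semiLexMatrix_block_zero q r m hm, semiLexMatrix_block_succ q r m hm])]
        simp [← Finset.sum_mul, sum_semiLexMatrix]
      | succ j =>
        rw [sum_fin_three_pow_succ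
          (fun _ r => semiLexMatrix k r i * semiLexMatrix k r j) _
          (fun q r m hm => by
            rw [semiLexMatrix_block_succ q r m hm, semiLexMatrix_block_succ q r m hm])]
        simp only [ih, Fin.succ_inj, Fin.sum_univ_three]
        split_ifs <;> ring

variable {N : ℕ} (S : Scheme N)

/-- The factor is the inverse of the common squared norm of the orthogonal columns. -/
theorem Scheme.factor_mul_sum (i j : Fin N) :
    S.factor * ∑ m, S.matrix m i * S.matrix m j = if i = j then 1 else 0 := by
  cases S with
  | semiLex =>
    change 1 / (2 * 3 ^ N) * ∑ m, semiLexMatrix N m i * semiLexMatrix N m j = _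
    rw [sum_semiLexMatrix_mul]
    split_ifs
    · field_simp
    · simp
  | perm σ =>
    change 1 * ∑ m : Fin N, σ.permMatrix ℝ m i * σ.permMatrix ℝ m j = _
    -- Row `σ.symm m` of the permutation matrix is the m-th unit vector.
    rw [one_mul, ← Equiv.sum_comp σ.symm]
    simp [Equiv.Perm.permMatrix, PEquiv.toMatrix_apply, Finset.sum_ite_eq, eq_comm]

/-- The perturbations form a tight frame. -/
theorem Scheme.factor_smul_sum_inner (v : Vec N) :
    S.factor • ∑ m, inner ℝ v (S.dir m) • S.dir m = v := by
  ext j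
  have h1 : ∀ m, inner ℝ v (S.dir m) = ∑ i, S.matrix m i * v i := fun m => by
    simp [Scheme.dir, PiLp.inner_apply]
  simp only [PiLp.smul_apply, WithLp.ofLp_sum, Finset.sum_apply, smul_eq_mul, WithLp.ofLp_smul,
    Pi.smul_apply, h1]
  change S.factor * ∑ m, (∑ i, S.matrix m i * v i) * S.matrix m j = v j
  simp only [Finset.sum_mul]
  rw [Finset.sum_comm, Finset.mul_sum]
  have h2 : ∀ i, S.factor * ∑ m, S.matrix m i * v i * S.matrix m j
      = (if i = j then 1 else 0) * v i := fun i => by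
    rw [← S.factor_mul_sum i j, mul_assoc, Finset.sum_mul]
    congr 1
    exact Finset.sum_congr rfl fun m _ => by ring
  simp [h2]

end Scheme

/-! ### Convergence of square-integrable martingale series -/

section MartingaleSeries

variable {Ω : Type*} {mΩ : MeasurableSpace Ω} {μ : Measure Ω}

/-- A series of square-integrable martingale differences with summable second moments converges
almost surely. -/
theorem ae_exists_tendsto_sum_of_condExp_eq_zero [IsProbabilityMeasure μ] {ℱ : Filtration ℕ mΩ} {w : ℕ → Ω → ℝ}
    (hw : ∀ n, StronglyMeasurable[ℱ (n + 1)] (w n)) (hL2 : ∀ n, MemLp (w n) 2 μ)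
    (hc : ∀ n, μ[w n | ℱ n] =ᵐ[μ] 0) {v : ℕ → ℝ} (hv : ∀ n, ∫ ω, w n ω ^ 2 ∂μ ≤ v n)
    (hvs : Summable v) :
    ∀ᵐ ω ∂μ, ∃ l, Tendsto (fun n => ∑ k ∈ Finset.range n, w k ω) atTop (𝓝 l) := by
  set M : ℕ → Ω → ℝ := fun n ω => ∑ k ∈ Finset.range n, w k ω with hM
  have hMsucc : ∀ n, M (n + 1) = M n + w n := fun n => by
    funext ω; exact Finset.sum_range_succ _ _
  have hML2 : ∀ n, MemLp (M n) 2 μ := fun n => memLp_finsetSum _ fun k _ => hL2 k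
  have hadp : StronglyAdapted ℱ M := by
    intro n
    induction n with
    | zero => simpa [hM] using stronglyMeasurable_const
    | succ n ih =>
      rw [hMsucc]
      exact (ih.mono (ℱ.mono n.le_succ)).add (hw n)
  have hmart : Martingale M ℱ μ :=
    martingale_of_condExp_sub_eq_zero_nat hadp (fun n => (hML2 n).integrable one_le_two)
      (fun n => by rw [hMsucc, add_sub_cancel_left]; exact hc n)
  have hv0 : ∀ n, 0 ≤ v n := fun n => (integral_nonneg fun ω => sq_nonneg _).trans (hv n)
  -- Increments are orthogonal to the past, so second moments add up.
  have hcross : ∀ n, ∫ ω, M n ω * w n ω ∂μ = 0 := fun n => by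
    have hint : Integrable (M n * w n) μ := (hML2 n).integrable_mul (hL2 n)
    have h1 := condExp_mul_of_stronglyMeasurable_left (hadp n) hint
      ((hL2 n).integrable one_le_two)
    have h2 : μ[M n * w n | ℱ n] =ᵐ[μ] 0 := by
      filter_upwards [h1, hc n] with ω e1 e2
      rw [e1, Pi.mul_apply, e2, Pi.zero_apply, mul_zero]
    have h3 := integral_condExp (μ := μ) (f := M n * w n) (ℱ.le n)
    rw [integral_congr_ae h2] at h3
    simpa using h3.symm
  have hsq : ∀ n, ∫ ω, M n ω ^ 2 ∂μ ≤ ∑ k ∈ Finset.range n, v k := by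
    intro n
    induction n with
    | zero => simp [hM]
    | succ n ih =>
      have h1 : ∀ ω, M (n + 1) ω ^ 2 = M n ω ^ 2 + 2 * (M n ω * w n ω) + w n ω ^ 2 := fun ω => by
        rw [hMsucc, Pi.add_apply]; ring
      have i1 := (hML2 n).integrable_sq
      have i2 : Integrable (fun ω => 2 * (M n ω * w n ω)) μ :=
        ((hML2 n).integrable_mul (hL2 n)).const_mul 2
      simp only [h1]
      have i3 : Integrable (fun ω => M n ω ^ 2 + 2 * (M n ω * w n ω)) μ := i1.add i2
      rw [integral_add i3 (hL2 n).integrable_sq, integral_add i1 i2,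
        integral_const_mul, hcross, Finset.sum_range_succ]
      have := hv n
      linarith
  -- |t| ≤ 1 + t² turns the second-moment bound into the L¹ bound needed for Doob's convergence
  -- theorem.
  have hbound : ∀ n, eLpNorm (M n) 1 μ ≤ ((1 + ∑' k, v k).toNNReal : NNReal) := fun n => by
    have i0 := (hML2 n).integrable one_le_two
    rw [eLpNorm_one_eq_lintegral_enorm, ← ofReal_integral_norm_eq_lintegral_enorm i0]
    refine ENNReal.ofReal_le_ofReal ?_
    have h1 : ∫ ω, ‖M n ω‖ ∂μ ≤ ∫ ω, (1 + M n ω ^ 2) ∂μ :=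
      integral_mono i0.norm ((integrable_const 1).add (hML2 n).integrable_sq) fun ω => by
        have := sq_nonneg (|M n ω| - 1)
        have h2 := sq_abs (M n ω)
        have := abs_nonneg (M n ω)
        simp only [Real.norm_eq_abs]
        nlinarith
    rw [integral_add (integrable_const 1) (hML2 n).integrable_sq] at h1
    have h3 := hvs.sum_le_tsum (Finset.range n) fun k _ => hv0 k
    have h4 := hsq n
    simp only [integral_const, probReal_univ, smul_eq_mul, mul_one] at h1
    linarith
  filter_upwards [hmart.submartingale.ae_tendsto_limitProcess hbound] with ω hω
  exact ⟨_, hω⟩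

/-- A measurable function with finite second moment, in the form of a lower integral. -/
theorem memLp_two_and_integral_sq_le {g : Ω → ℝ} (hg : Measurable g) {α : ℝ} (hα : 0 ≤ α)
    (h : ∫⁻ ω, ENNReal.ofReal (|g ω| ^ 2) ∂μ ≤ ENNReal.ofReal α) :
    MemLp g 2 μ ∧ ∫ ω, g ω ^ 2 ∂μ ≤ α := by
  simp only [sq_abs] at h
  have hi : Integrable (fun ω => g ω ^ 2) μ :=
    (lintegral_ofReal_ne_top_iff_integrable (hg.pow_const 2).aestronglyMeasurable
      (ae_of_all _ fun ω => sq_nonneg _)).1 (ne_top_of_le_ne_top ENNReal.ofReal_ne_top h)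
  refine ⟨(memLp_two_iff_integrable_sq hg.aestronglyMeasurable).2 hi, ?_⟩
  rw [← ofReal_integral_eq_lintegral_ofReal hi (ae_of_all _ fun ω => sq_nonneg _)] at h
  exact (ENNReal.ofReal_le_ofReal_iff hα).1 h

end MartingaleSeries

/-! ### Splitting the gradient estimate into bias and noise -/

section Noise

variable {N : ℕ}

/-- The contribution of the measurement noise to the gradient estimate. -/
noncomputable def noiseTerm (S : Scheme N) (δ : ℕ → ℝ) (n : ℕ) (e : Fin S.len → ℝ) : Vec N :=
  S.factor • ∑ m : Fin S.len, (e m / (2 * δ (n * S.len + m))) • S.dir m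

theorem gradEst_eq_add_noiseTerm (S : Scheme N) (f : Vec N → ℝ) (δ : ℕ → ℝ) (n : ℕ) (u : Vec N)
    (ep em : Fin S.len → ℝ) :
    gradEst S f δ n u ep em = gradEst S f δ n u 0 0 + noiseTerm S δ n (ep - em) := by
  simp only [gradEst, noiseTerm, ← smul_add, ← Finset.sum_add_distrib, ← add_smul]
  congr 1
  refine Finset.sum_congr rfl fun m _ => ?_
  congr 1
  simp only [Pi.zero_apply, Pi.sub_apply]
  ring

theorem noiseTerm_apply (S : Scheme N) (δ : ℕ → ℝ) (n : ℕ) (e : Fin S.len → ℝ) (i : Fin N) :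
    noiseTerm S δ n e i =
      ∑ m, (S.factor * S.matrix m i / 2) * (1 / δ (n * S.len + m)) * e m := by
  simp only [noiseTerm, Scheme.dir, PiLp.smul_apply, WithLp.ofLp_sum, Finset.sum_apply,
    smul_eq_mul, Finset.mul_sum]
  refine Finset.sum_congr rfl fun m _ => ?_
  ring

theorem continuous_gradEst (S : Scheme N) {f : Vec N → ℝ} (hf : Continuous f) (δ : ℕ → ℝ) (n : ℕ) :
    Continuous fun u => gradEst S f δ n u 0 0 := by
  unfold gradEst
  fun_prop

/-- The estimate without noise is asymptotically unbiased along bounded sequences. -/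
theorem tendsto_gradEst_sub (S : Scheme N) {f : Vec N → ℝ} {G : Vec N → Vec N}
    (hf : ∀ u, HasFDerivAt f (innerSL ℝ (G u)) u) (hG : Continuous G) {δ : ℕ → ℝ}
    (hδ_pos : ∀ n, 0 < δ n) (hδ : Tendsto δ atTop (𝓝 0)) {u : ℕ → Vec N} {R : ℝ}
    (hu : ∀ n, ‖u n‖ ≤ R) :
    Tendsto (fun n => gradEst S f δ n (u n) 0 0 - G (u n)) atTop (𝓝 0) := by
  -- Expanding G (u n) in the tight frame reduces the bias to one central difference error per
  -- direction.
  have hrepr : ∀ n, gradEst S f δ n (u n) 0 0 - G (u n) = S.factor • ∑ m : Fin S.len,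
      ((f (u n + δ (n * S.len + m) • S.dir m) - f (u n - δ (n * S.len + m) • S.dir m))
        / (2 * δ (n * S.len + m)) - inner ℝ (G (u n)) (S.dir m)) • S.dir m := fun n => by
    simp only [sub_smul, Finset.sum_sub_distrib, smul_sub, S.factor_smul_sum_inner]
    simp [gradEst]
  have hzero : (0 : Vec N) = S.factor • ∑ m : Fin S.len, (0 : ℝ) • S.dir m := by simp
  simp only [hrepr]
  rw [hzero]
  refine (tendsto_finsetSum _ fun m _ => Tendsto.smul_const ?_ _).const_smul S.factor
  have hδm : Tendsto (fun n => δ (n * S.len + m)) atTop (𝓝 0) := by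
    refine hδ.comp (tendsto_atTop_mono (fun n => ?_) tendsto_id)
    have := Nat.le_mul_of_pos_right n m.pos
    simp only [id]
    omega
  rw [Metric.tendsto_atTop']
  intro ε hε
  set d := S.dir m
  -- Radius R + 1 leaves room for the shifted points u n ± s • d; the + 1 in the denominator covers
  -- d = 0.
  obtain ⟨h, hh, H⟩ := exists_abs_sub_sub_inner_le hf hG (R + 1)
    (show 0 < ε / (2 * (‖d‖ + 1)) by positivity)
  have hδd : Tendsto (fun n => δ (n * S.len + m) * ‖d‖) atTop (𝓝 0) := by
    simpa using hδm.mul_const ‖d‖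
  obtain ⟨n₀, hn₀⟩ := eventually_atTop.1 ((hδd.eventually_lt_const hh).and
    (hδd.eventually_lt_const one_pos))
  refine ⟨n₀, fun n hn => ?_⟩
  obtain ⟨h1, h2⟩ := hn₀ n hn.le
  have hs := hδ_pos (n * S.len + m)
  set s := δ (n * S.len + m)
  have hnorm : ‖s • d‖ = s * ‖d‖ := by rw [norm_smul, Real.norm_of_nonneg hs.le]
  have hR := hu n
  have hp := H (u n) (u n + s • d) (by linarith)
    ((norm_add_le _ _).trans (by rw [hnorm]; linarith)) (by rw [add_sub_cancel_left, hnorm]; exact h1)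
  have hm := H (u n) (u n - s • d) (by linarith)
    ((norm_sub_le _ _).trans (by rw [hnorm]; linarith))
    (by rw [sub_sub_cancel_left, norm_neg, hnorm]; exact h1)
  rw [add_sub_cancel_left, hnorm, inner_smul_right] at hp
  rw [sub_sub_cancel_left, norm_neg, hnorm, inner_neg_right, inner_smul_right] at hm
  have hη : ε / (2 * (‖d‖ + 1)) * (s * ‖d‖) < s * ε := by
    rw [div_mul_eq_mul_div, div_lt_iff₀ (by positivity)]
    have := mul_pos hs hε
    have := mul_nonneg this.le (norm_nonneg d)
    nlinarith
  rw [Real.dist_eq, sub_zero]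
  have hrw : (f (u n + s • d) - f (u n - s • d)) / (2 * s) - inner ℝ (G (u n)) d
      = ((f (u n + s • d) - f (u n - s • d)) - 2 * (s * inner ℝ (G (u n)) d)) / (2 * s) := by
    field_simp
  rw [hrw, abs_div, abs_of_pos (show 0 < 2 * s by positivity), div_lt_iff₀ (by positivity), abs_lt]
  rw [abs_le] at hp hm
  constructor <;> linarith [hp.1, hp.2, hm.1, hm.2]

end Noise

/-! ### Pathwise convergence of the noisy scheme -/

section Deterministic

variable {E : Type*} [NormedAddCommGroup E] [InnerProductSpace ℝ E] [ProperSpace E]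

/-- A gradient scheme with vanishing bias and convergent accumulated noise that clusters at a point
attracted to `xs` by the gradient flow converges to `xs`. -/
theorem tendsto_of_gradient_scheme {f : E → ℝ} {G : E → E}
    (hf : ∀ u, HasFDerivAt f (innerSL ℝ (G u)) u) (hG : Continuous G)
    (hGL : ∀ R, ∃ L : NNReal, LipschitzOnWith L G (Metric.closedBall 0 R))
    {a : ℕ → ℝ} {x b w : ℕ → E}
    (hx : ∀ n, x (n + 1) = x n - a n • (G (x n) + b n) - w n)
    (hxb : BddAbove (Set.range fun n => ‖x n‖))
    (hb : Tendsto b atTop (𝓝 0)) (ha : Tendsto a atTop (𝓝 0)) (ha_pos : ∀ n, 0 < a n)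
    (ha_sum : Tendsto (fun n => ∑ k ∈ Finset.range n, a k) atTop atTop)
    {l : E} (hw : Tendsto (fun n => ∑ k ∈ Finset.range n, w k) atTop (𝓝 l))
    {xs : E} {r : ℝ} (hr : 0 < r)
    (hmin : ∀ u, dist u xs < r → u ≠ xs → f xs < f u ∧ G u ≠ 0)
    {y : ℝ → E} (hy : ∀ t, 0 ≤ t → HasDerivWithinAt y (-G (y t)) (Set.Ici 0) t)
    (hylim : Tendsto y atTop (𝓝 xs)) (hclust : MapClusterPt (y 0) atTop x) :
    Tendsto x atTop (𝓝 xs) := by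
  obtain ⟨R₁, hR₁⟩ := hxb
  replace hR₁ : ∀ n, ‖x n‖ ≤ R₁ := fun n => hR₁ ⟨n, rfl⟩
  -- Since e (n + 1) - e n = w n, the shifted sequence x + e has no noise term; moving G from x to x
  -- + e costs at most L * ‖e n‖.
  set e : ℕ → E := fun n => (∑ k ∈ Finset.range n, w k) - l with he
  have he0 : Tendsto e atTop (𝓝 0) := by simpa [he] using hw.sub_const l
  obtain ⟨R₂, hR₂⟩ := he0.norm.bddAbove_range
  replace hR₂ : ∀ n, ‖e n‖ ≤ R₂ := fun n => hR₂ ⟨n, rfl⟩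
  have hR₂0 : 0 ≤ R₂ := (norm_nonneg _).trans (hR₂ 0)
  set z : ℕ → E := fun n => x n + e n with hz
  set R := R₁ + R₂ with hR
  have hzR : ∀ n, ‖z n‖ ≤ R := fun n => (norm_add_le _ _).trans (add_le_add (hR₁ n) (hR₂ n))
  set b' : ℕ → E := fun n => G (x n) - G (z n) + b n with hb'
  have hzrec : ∀ n, z (n + 1) = z n - a n • (G (z n) + b' n) := fun n => by
    have h1 : G (z n) + b' n = G (x n) + b n := by simp only [hb']; abel
    rw [h1]
    simp only [hz, he, hx, Finset.sum_range_succ]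
    abel
  have hb'0 : Tendsto b' atTop (𝓝 0) := by
    obtain ⟨L, hL⟩ := hGL R
    have h1 : Tendsto (fun n => G (x n) - G (z n)) atTop (𝓝 0) := by
      refine squeeze_zero_norm (a := fun n => L * ‖e n‖) (fun n => ?_) (by
        simpa using he0.norm.const_mul (L : ℝ))
      have := hL.norm_sub_le (x := x n) (y := z n) (by simpa using (hR₁ n).trans (by linarith))
        (by simpa using hzR n)
      simpa [hz] using this
    simpa using h1.add hb
  have hyfreq : ∀ ε > 0, ∃ᶠ n in atTop, dist (z n) xs < ε := by
    intro ε hε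
    obtain ⟨T, hT⟩ := eventually_atTop.1 (hylim.eventually (Metric.ball_mem_nhds xs (half_pos hε)))
    have hT0 : (0 : ℝ) ≤ max T 0 := le_max_right _ _
    have hyc : ContinuousOn y (Set.Icc 0 (max T 0 + 1)) := fun t ht =>
      ((hy t ht.1).mono Set.Icc_subset_Ici_self).continuousWithinAt
    obtain ⟨R₃, hR₃⟩ := isCompact_Icc.exists_bound_of_continuousOn hyc
    obtain ⟨L, hL⟩ := hGL (max R R₃)
    obtain ⟨M, hM⟩ := (isCompact_closedBall (0 : E) (max R R₃)).exists_bound_of_continuousOn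
      hG.continuousOn
    obtain ⟨ρ, hρ, htrack⟩ := exists_euler_near_flow hL hM hy hT0
      (fun t ht => by simpa using Or.inr (hR₃ t ht)) hzrec
      (fun n => by simpa using Or.inl (hzR n)) hb'0 ha ha_pos ha_sum (half_pos hε)
    have hnear : ∃ᶠ n in atTop, ‖z n - y 0‖ < ρ := by
      have h1 := hclust.frequently (Metric.ball_mem_nhds (y 0) (half_pos hρ))
      have h2 : ∀ᶠ n in atTop, ‖e n‖ < ρ / 2 :=
        (by simpa using he0.norm : Tendsto (fun n => ‖e n‖) atTop (𝓝 0)).eventually_lt_const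
          (half_pos hρ)
      refine (h1.and_eventually h2).mono fun n hn => ?_
      have h3 : dist (x n) (y 0) < ρ / 2 := hn.1
      rw [dist_eq_norm] at h3
      have h4 : z n - y 0 = (x n - y 0) + e n := by simp only [hz]; abel
      rw [h4]
      linarith [norm_add_le (x n - y 0) (e n), hn.2]
    rw [frequently_atTop]
    intro m
    obtain ⟨n, ⟨hn1, hn2⟩, hnm⟩ :=
      ((hnear.and_eventually htrack).and_eventually (eventually_ge_atTop m)).exists
    obtain ⟨k, hk, t, ht, hkt⟩ := hn2 hn1
    refine ⟨k, hnm.trans hk, ?_⟩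
    have h1 : dist (y t) xs < ε / 2 := hT t ((le_max_left _ _).trans ht)
    rw [← dist_eq_norm] at hkt
    linarith [dist_triangle (z k) (y t) xs]
  have hzlim := tendsto_of_frequently_near hf hG hzrec hzR hb'0 ha ha_pos hr hmin hyfreq
  have hxz : x = fun n => z n - e n := by funext n; simp [hz]
  rw [hxz]
  simpa using hzlim.sub he0

end Deterministic

/-! ### Moments of weighted sums of noises -/

section WeightedSums

variable {Ω ι : Type*} {mΩ : MeasurableSpace Ω} {μ : Measure Ω} [Fintype ι]

/-- Cauchy–Schwarz, so that noises within one outer iteration may be arbitrarily correlated. -/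
theorem integral_sq_sum_mul_le (c : ι → ℝ) {g : ι → Ω → ℝ} {β : ℝ}
    (hg : ∀ m, MemLp (g m) 2 μ) (hβ : ∀ m, ∫ ω, g m ω ^ 2 ∂μ ≤ β) :
    ∫ ω, (∑ m, c m * g m ω) ^ 2 ∂μ ≤ (Fintype.card ι : ℝ) * ∑ m, c m ^ 2 * β := by
  have i1 : ∀ m, Integrable (fun ω => c m ^ 2 * g m ω ^ 2) μ := fun m =>
    (hg m).integrable_sq.const_mul _
  have i2 : MemLp (fun ω => ∑ m, c m * g m ω) 2 μ :=
    memLp_finsetSum _ fun m _ => (hg m).const_mul _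
  calc ∫ ω, (∑ m, c m * g m ω) ^ 2 ∂μ
      ≤ ∫ ω, (Fintype.card ι : ℝ) * ∑ m, c m ^ 2 * g m ω ^ 2 ∂μ :=
        integral_mono i2.integrable_sq
          ((integrable_finsetSum _ fun m _ => i1 m).const_mul _) fun ω => by
          have := sq_sum_le_card_mul_sum_sq (s := (Finset.univ : Finset ι))
            (f := fun m => c m * g m ω)
          simpa [mul_pow] using this
    _ ≤ _ := by
        rw [integral_const_mul, integral_finsetSum _ fun m _ => i1 m]
        refine mul_le_mul_of_nonneg_left (Finset.sum_le_sum fun m _ => ?_) (Nat.cast_nonneg _)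
        rw [integral_const_mul]
        exact mul_le_mul_of_nonneg_left (hβ m) (sq_nonneg _)

theorem condExp_sum_mul_eq_zero (c : ι → ℝ) {g : ι → Ω → ℝ} (𝒢 : MeasurableSpace Ω)
    (hg : ∀ m, Integrable (g m) μ) (h0 : ∀ m, μ[g m | 𝒢] =ᵐ[μ] 0) :
    μ[fun ω => ∑ m, c m * g m ω | 𝒢] =ᵐ[μ] 0 := by
  have h : (fun ω => ∑ m, c m * g m ω) = ∑ m, c m • g m := by
    funext ω; simp [Finset.sum_apply]
  rw [h]
  refine (condExp_finsetSum (fun m _ => (hg m).smul _) _).trans ?_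
  have h1 : ∀ᵐ ω ∂μ, ∀ m, (μ[c m • g m | 𝒢]) ω = 0 := by
    rw [ae_all_iff]
    intro m
    filter_upwards [condExp_smul (μ := μ) (c m) (g m) 𝒢, h0 m] with ω e1 e2
    rw [e1, Pi.smul_apply, e2, Pi.zero_apply, smul_zero]
  filter_upwards [h1] with ω hω
  simp [Finset.sum_apply, hω]

theorem integral_sub_sq_le {p q : Ω → ℝ} {α : ℝ} (hp : MemLp p 2 μ) (hq : MemLp q 2 μ)
    (hpα : ∫ ω, p ω ^ 2 ∂μ ≤ α) (hqα : ∫ ω, q ω ^ 2 ∂μ ≤ α) :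
    ∫ ω, (p ω - q ω) ^ 2 ∂μ ≤ 4 * α := by
  have i1 := hp.integrable_sq.const_mul 2
  have i2 := hq.integrable_sq.const_mul 2
  calc ∫ ω, (p ω - q ω) ^ 2 ∂μ ≤ ∫ ω, (2 * p ω ^ 2 + 2 * q ω ^ 2) ∂μ :=
        integral_mono (hp.sub hq).integrable_sq (i1.add i2) fun ω => by
          simp only
          nlinarith [sq_nonneg (p ω + q ω)]
    _ ≤ 4 * α := by
        rw [integral_add i1 i2, integral_const_mul, integral_const_mul]
        linarith

end WeightedSums

/-! ### Almost sure convergence of the accumulated noise -/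

section Noise

theorem measurable_history {N : ℕ} {Ω : Type*} {x : ℕ → Ω → Vec N} {k n : ℕ} (h : k ≤ n) :
    Measurable[history x n] (x k) := by
  rw [measurable_iff_comap_le]
  exact le_iSup₂_of_le k h le_rfl

variable {N : ℕ} {Ω : Type*} [mΩ : MeasurableSpace Ω]

/-- The filtration generated by the iterates from time `1` on. -/
def historyFiltration {x : ℕ → Ω → Vec N} (hx : ∀ n, Measurable (x n)) : Filtration ℕ mΩ where
  seq n := history x (n + 1)
  mono' _ _ h := iSup₂_le fun k hk => le_iSup₂_of_le k (by omega) le_rfl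
  le' _ := iSup₂_le fun k _ => (hx k).comap_le

theorem continuous_noiseTerm (S : Scheme N) (δ : ℕ → ℝ) (n : ℕ) :
    Continuous (noiseTerm S δ n) := by
  unfold noiseTerm
  fun_prop

theorem measurable_iterates {S : Scheme N} {f : Vec N → ℝ} (hf : Continuous f) {a δ : ℕ → ℝ}
    {ξp ξm : ℕ → Fin S.len → Ω → ℝ} {x : ℕ → Ω → Vec N}
    (hξp : ∀ n m, Measurable (ξp n m)) (hξm : ∀ n m, Measurable (ξm n m))
    (hx0 : Measurable (x 0))
    (hx : ∀ n ω, x (n + 1) ω =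
      x n ω - a n • gradEst S f δ n (x n ω) (fun m => ξp n m ω) (fun m => ξm n m ω)) (n : ℕ) :
    Measurable (x n) := by
  induction n with
  | zero => exact hx0
  | succ n ih =>
    have h : x (n + 1) = fun ω => x n ω - a n • (gradEst S f δ n (x n ω) 0 0
        + noiseTerm S δ n ((fun m => ξp n m ω) - fun m => ξm n m ω)) := by
      funext ω
      rw [hx, gradEst_eq_add_noiseTerm]
    rw [h]
    have hc : Continuous fun p : Vec N × (Fin S.len → ℝ) =>
        p.1 - a n • (gradEst S f δ n p.1 0 0 + noiseTerm S δ n p.2) := by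
      have h1 := (continuous_gradEst S hf δ n).comp
        (continuous_fst : Continuous fun p : Vec N × (Fin S.len → ℝ) => p.1)
      have h2 := (continuous_noiseTerm S δ n).comp
        (continuous_snd : Continuous fun p : Vec N × (Fin S.len → ℝ) => p.2)
      exact continuous_fst.sub ((h1.add h2).const_smul (a n))
    exact hc.measurable.comp (ih.prodMk (measurable_pi_lambda _ fun m => (hξp n m).sub (hξm n m)))

/-- The accumulated measurement noise converges almost surely, coordinate by coordinate. -/
theorem ae_exists_tendsto_sum_noiseTerm_apply {S : Scheme N} {f : Vec N → ℝ} (hf : Continuous f)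
    {μ : Measure Ω} [IsProbabilityMeasure μ] {a δ : ℕ → ℝ}
    {ξp ξm : ℕ → Fin S.len → Ω → ℝ} {x : ℕ → Ω → Vec N}
    (hξp : ∀ n m, Measurable (ξp n m)) (hξm : ∀ n m, Measurable (ξm n m))
    (hx0 : Measurable (x 0))
    (hx : ∀ n ω, x (n + 1) ω =
      x n ω - a n • gradEst S f δ n (x n ω) (fun m => ξp n m ω) (fun m => ξm n m ω))
    (hnoise : ∀ n, 1 ≤ n → ∀ m, μ[fun ω => ξp n m ω - ξm n m ω | history x n] =ᵐ[μ] 0)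
    {α : ℝ} (hα : 0 ≤ α) (hnoise2 : ∀ n m,
      ∫⁻ ω, ENNReal.ofReal (|ξp n m ω| ^ 2) ∂μ ≤ ENNReal.ofReal α ∧
      ∫⁻ ω, ENNReal.ofReal (|ξm n m ω| ^ 2) ∂μ ≤ ENNReal.ofReal α)
    (haδ : ∀ m : Fin S.len, Summable fun n => (a n / δ (n * S.len + m)) ^ 2) (i : Fin N) :
    ∀ᵐ ω ∂μ, ∃ l, Tendsto (fun n => ∑ k ∈ Finset.range n,
      a k * noiseTerm S δ k ((fun m => ξp k m ω) - fun m => ξm k m ω) i) atTop (𝓝 l) := by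
  have hxm := measurable_iterates hf hξp hξm hx0 hx
  set ℱ := historyFiltration hxm
  set g : ℕ → Fin S.len → Ω → ℝ := fun n m ω => ξp n m ω - ξm n m ω with hg
  have hp := fun n m => memLp_two_and_integral_sq_le (hξp n m) hα (hnoise2 n m).1
  have hm := fun n m => memLp_two_and_integral_sq_le (hξm n m) hα (hnoise2 n m).2
  have hgL2 : ∀ n m, MemLp (g n m) 2 μ := fun n m => (hp n m).1.sub (hm n m).1
  have hgsq : ∀ n m, ∫ ω, g n m ω ^ 2 ∂μ ≤ 4 * α := fun n m =>
    integral_sub_sq_le (hp n m).1 (hm n m).1 (hp n m).2 (hm n m).2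
  set c : ℕ → Fin S.len → ℝ := fun n m =>
    (S.factor * S.matrix m i / 2) * (a n / δ (n * S.len + m)) with hc
  set w : ℕ → Ω → ℝ := fun n ω => ∑ m, c n m * g n m ω with hwdef
  have hwa : ∀ n ω, a n * noiseTerm S δ n ((fun m => ξp n m ω) - fun m => ξm n m ω) i
      = w n ω := fun n ω => by
    rw [noiseTerm_apply, Finset.mul_sum]
    refine Finset.sum_congr rfl fun m _ => ?_
    simp only [hc, hg, Pi.sub_apply]
    ring
  simp only [hwa]
  have hwL2 : ∀ n, MemLp (w n) 2 μ := fun n =>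
    memLp_finsetSum _ fun m _ => (hgL2 n m).const_mul _
  -- Individual noises need not be measurable with respect to the history of the iterates, but their
  -- weighted sum is recovered from x n and x (n + 1) through the recursion.
  have hwm : ∀ n, StronglyMeasurable[history x (n + 1)] (w n) := fun n => by
    have h : w n = fun ω => x n ω i - x (n + 1) ω i - a n * gradEst S f δ n (x n ω) 0 0 i := by
      funext ω
      rw [← hwa, hx, gradEst_eq_add_noiseTerm]
      simp only [PiLp.sub_apply, PiLp.smul_apply, PiLp.add_apply, smul_eq_mul]
      ring
    rw [h]
    have ev : Measurable fun u : Vec N => u i :=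
      (EuclideanSpace.proj (𝕜 := ℝ) i).continuous.measurable
    have h1 := measurable_history (x := x) n.le_succ
    have h2 := measurable_history (x := x) (le_refl (n + 1))
    exact (((ev.comp h1).sub (ev.comp h2)).sub ((ev.comp
      ((continuous_gradEst S hf δ n).measurable.comp h1)).const_mul (a n))).stronglyMeasurable
  -- Centring is assumed only from n = 1 on, so the martingale starts with w 1; the single term w 0
  -- is added back at the end.
  have hwc : ∀ n, μ[w (n + 1) | history x (n + 1)] =ᵐ[μ] 0 := fun n =>
    condExp_sum_mul_eq_zero _ _ (fun m => (hgL2 _ m).integrable one_le_two)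
      fun m => hnoise (n + 1) (by omega) m
  have hwsq : ∀ n, ∫ ω, w n ω ^ 2 ∂μ ≤ (S.len : ℝ) * ∑ m, c n m ^ 2 * (4 * α) := fun n => by
    simpa using integral_sq_sum_mul_le (c n) (hgL2 n) (hgsq n)
  have hsum : Summable fun n : ℕ => (S.len : ℝ) * ∑ m, c n m ^ 2 * (4 * α) := by
    refine Summable.mul_left _ (summable_sum fun m _ => Summable.mul_right _ ?_)
    simp only [hc, mul_pow]
    exact (haδ m).mul_left _
  set v : ℕ → ℝ := fun n => (S.len : ℝ) * ∑ m, c n m ^ 2 * (4 * α)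
  have hsum' : Summable fun n => v (n + 1) := (summable_nat_add_iff 1).2 hsum
  have hconv := ae_exists_tendsto_sum_of_condExp_eq_zero (ℱ := ℱ) (w := fun n => w (n + 1))
    (v := fun n => v (n + 1)) (fun n => hwm (n + 1)) (fun n => hwL2 (n + 1)) (fun n => hwc n)
    (fun n => hwsq (n + 1)) hsum'
  filter_upwards [hconv] with ω hω
  obtain ⟨l, hl⟩ := hω
  have h := hl.add_const (w 0 ω)
  simp only [← Finset.sum_range_succ' fun k => w k ω] at h
  exact ⟨_, (tendsto_add_atTop_iff_nat (f := fun n => ∑ k ∈ Finset.range n, w k ω) 1).1 h⟩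

end Noise

/-! ### Regularity of the gradient and strict minimality of the equilibrium -/

section Gradient

variable {N : ℕ} {f : Vec N → ℝ}

theorem hasFDerivAt_innerSL_gradient (hf : Differentiable ℝ f) (u : Vec N) :
    HasFDerivAt f (innerSL ℝ (gradient f u)) u :=
  (hf u).hasGradientAt.hasFDerivAt

theorem contDiff_gradient (hf : ContDiff ℝ 2 f) : ContDiff ℝ 1 (gradient f) :=
  (InnerProductSpace.toDual ℝ (Vec N)).symm.contDiff.comp (hf.fderiv_right (by norm_num))

/-- An asymptotically stable equilibrium of a gradient flow is a strict local minimum and isolated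
among the critical points. -/
theorem IsAsymptoticallyStable.exists_strict_min (hf : Differentiable ℝ f)
    (hGL : ∀ R, ∃ L : NNReal, LipschitzOnWith L (gradient f) (Metric.closedBall 0 R))
    {xs : Vec N} (hxs : IsAsymptoticallyStable f xs) :
    ∃ r > 0, ∀ u, dist u xs < r → u ≠ xs → f xs < f u ∧ gradient f u ≠ 0 := by
  obtain ⟨r, hr, hsub⟩ := hxs.attractive
  refine ⟨r, hr, fun u hu hne => ?_⟩
  obtain ⟨y, ⟨rfl, hy⟩, hlim⟩ := hsub hu
  exact lt_and_ne_zero_of_flow_tendsto (hasFDerivAt_innerSL_gradient hf) hGL hy hlim hne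

end Gradient

end RDSA

/-! ### Strong convergence -/

theorem mainTheorem1 {N : ℕ} (S : RDSA.Scheme N) (f : RDSA.Vec N → ℝ)
    {Ω : Type*} [MeasurableSpace Ω] (μ : Measure Ω) [IsProbabilityMeasure μ]
    (a δ : ℕ → ℝ) (ξp ξm : ℕ → Fin S.len → Ω → ℝ) (x : ℕ → Ω → RDSA.Vec N)
    -- the noises and the initial point are random variables, the iterates follow the algorithm
    (hξp : ∀ n m, Measurable (ξp n m)) (hξm : ∀ n m, Measurable (ξm n m))
    (hx0 : Measurable (x 0))
    (hx : ∀ n ω, x (n + 1) ω =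
      x n ω - a n • RDSA.gradEst S f δ n (x n ω) (fun m => ξp n m ω) (fun m => ξm n m ω))
    -- (A1)
    (hf : ContDiff ℝ 3 f)
    (hf3 : ∃ α₀ : ℝ, ∀ n, ∀ i₁ i₂ i₃ : Fin N, ∀ᵐ ω ∂μ,
      |iteratedFDeriv ℝ 3 f (x n ω) ![EuclideanSpace.single i₁ 1, EuclideanSpace.single i₂ 1,
        EuclideanSpace.single i₃ 1]| < α₀)
    -- (A2)
    (hnoise : ∀ n, 1 ≤ n → ∀ m,
      μ[fun ω => ξp n m ω - ξm n m ω | RDSA.history x n] =ᵐ[μ] 0)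
    -- (A3)
    (hnoise2 : ∃ α₀ : ℝ, 0 < α₀ ∧ ∀ n m,
      ∫⁻ ω, ENNReal.ofReal (|ξp n m ω| ^ 2) ∂μ ≤ ENNReal.ofReal α₀ ∧
      ∫⁻ ω, ENNReal.ofReal (|ξm n m ω| ^ 2) ∂μ ≤ ENNReal.ofReal α₀)
    (hf2 : ∀ η : ℝ, 0 < η → ∃ α₁ : ℝ, 0 < α₁ ∧ ∀ n m,
      ∫⁻ ω, ENNReal.ofReal (|f (x n ω + η • S.dir m)| ^ 2) ∂μ ≤ ENNReal.ofReal α₁ ∧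
      ∫⁻ ω, ENNReal.ofReal (|f (x n ω - η • S.dir m)| ^ 2) ∂μ ≤ ENNReal.ofReal α₁)
    -- (A4)
    (ha_pos : ∀ n, 0 < a n) (hδ_pos : ∀ n, 0 < δ n)
    (ha : Tendsto a atTop (𝓝 0)) (hδ : Tendsto δ atTop (𝓝 0))
    (ha_sum : Tendsto (fun n => ∑ k ∈ Finset.range n, a k) atTop atTop)
    (haδ : ∀ m : Fin S.len, Summable fun n => (a n / δ (n * S.len + m)) ^ 2)
    -- (A5)
    (hbdd : ∀ᵐ ω ∂μ, BddAbove (Set.range fun n => ‖x n ω‖))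
    -- the equilibrium and the recurrence condition
    (xs : RDSA.Vec N) (hxs : RDSA.IsAsymptoticallyStable f xs)
    (K : Set (RDSA.Vec N)) (hK : IsCompact K) (hKD : K ⊆ RDSA.attractionDomain f xs)
    (hrec : ∀ᵐ ω ∂μ, ∃ᶠ n in atTop, x n ω ∈ K) :
    ∀ᵐ ω ∂μ, Tendsto (fun n => x n ω) atTop (𝓝 xs) := by
  have hfd : Differentiable ℝ f := hf.differentiable (by norm_num)
  have hG1 := RDSA.contDiff_gradient (hf.of_le (by norm_num))
  have hGL : ∀ R, ∃ L : NNReal, LipschitzOnWith L (gradient f) (Metric.closedBall 0 R) := fun R =>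
    hG1.contDiffOn.exists_lipschitzOnWith one_ne_zero (convex_closedBall 0 R)
      (isCompact_closedBall 0 R)
  have hfG := RDSA.hasFDerivAt_innerSL_gradient hfd
  obtain ⟨r, hr, hmin⟩ := hxs.exists_strict_min hfd hGL
  obtain ⟨α, hα, hnoise2⟩ := hnoise2
  have hsum := ae_all_iff.2 fun i => RDSA.ae_exists_tendsto_sum_noiseTerm_apply hfd.continuous
    hξp hξm hx0 hx hnoise hα.le hnoise2 haδ i
  filter_upwards [hbdd, hrec, hsum] with ω hb hr' hs
  choose l hl using hs
  -- The path is now fixed; compactness turns recurrence into a cluster point from which the flow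
  -- reaches xs in the limit.
  obtain ⟨p, hpK, hp⟩ := hK.exists_mapClusterPt_of_frequently hr'
  obtain ⟨y, ⟨rfl, hy⟩, hlim⟩ := hKD hpK
  obtain ⟨R, hR⟩ := hb
  refine RDSA.tendsto_of_gradient_scheme hfG hG1.continuous hGL (x := fun n => x n ω)
    (b := fun n => RDSA.gradEst S f δ n (x n ω) 0 0 - gradient f (x n ω))
    (w := fun n => a n • RDSA.noiseTerm S δ n ((fun m => ξp n m ω) - fun m => ξm n m ω))
    (l := WithLp.toLp 2 l) (fun n => ?_) ⟨R, hR⟩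
    (RDSA.tendsto_gradEst_sub S hfG hG1.continuous hδ_pos hδ fun n => hR ⟨n, rfl⟩)
    ha ha_pos ha_sum ?_ hr hmin hy hlim hp
  · rw [hx, RDSA.gradEst_eq_add_noiseTerm, smul_add, add_sub_cancel]
    abel
  · have h := ((PiLp.continuous_toLp 2 fun _ : Fin N => ℝ).tendsto l).comp (tendsto_pi_nhds.2 hl)
    refine h.congr fun n => ?_
    ext i
    simp
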